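/- Here a knot is the image $\Gamma\subset\mathbb{R}^3$ of a continuous injective map $\mathbb{R}/\mathbb{Z}\to\mathbb{R}^3$. It is tame if it is ambient isotopic to a polygonal knot, and non-trivial if it is not ambient isotopic to a round circle. It has a rotational symmetry with angle $\varphi$ about an axis $v$ (an affine line in $\mathbb{R}^3$) if the rotation about $v$ by the angle $\varphi$ maps $\Gamma$ onto itself. **Theorem 4.10 (Rotational symmetries of knots).** Let $\Gamma$ be a non-trivial tame knot. If $\Gamma$ has a rotational symmetry about an axis $v$ with angle $\varphi\in(-\pi,\pi]\setminus\{0\}$ and $\Gamma\cap v\neq\emptyset$, then $\varphi=\pi$. If $\Gamma$ has rotational symmetries about two axes $v_1$ and $v_2$ with rotation angles $\varphi_1=\frac{2\pi}{a_1}$ and $\varphi_2=\frac{2\pi}{a_2}$, respectively, for some integers $a_1,a_2\ge 2$, then $v_1\cap v_2\neq\emptyset$. Furthermore, if $v_1\cap v_2=\{p\}$ for some $p\in\mathbb{R}^3$, the following holds. 1. If $\varphi_1\neq\varphi_2$, then (i) $v_1\perp v_2$; (ii) either $a_1=2$ and $a_2\ge 3$, or $a_2=2$ and $a_1\ge 3$;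 (iii) if $a_1=2$, then $v_1\cap\Gamma\neq\emptyset$ and $v_2\cap\Gamma=\emptyset$; if $a_2=2$, then $v_2\cap\Gamma\neq\emptyset$ and $v_1\cap\Gamma=\emptyset$. 2. If $\varphi_1=\varphi_2$, then $\varphi_1=\varphi_2=\pi$. -/

import Mathlib

/-- Euclidean three-space. -/
abbrev Space3 : Type := EuclideanSpace ℝ (Fin 3)

/-- A knot: the image of a continuous injective map from the circle `ℝ/ℤ` into three-space. -/
def IsKnot (Γ : Set Space3) : Prop :=
  ∃ γ : AddCircle (1 : ℝ) → Space3, Continuous γ ∧ Function.Injective γ ∧ Set.range γ = Γ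

/-- `Γ` and `Γ'` are ambient isotopic: there is a continuous family of self-homeomorphisms of
three-space, parametrized by `[0, 1]`, starting at the identity and ending at a homeomorphism
that carries `Γ` onto `Γ'`. -/
def AmbientIsotopic (Γ Γ' : Set Space3) : Prop :=
  ∃ H : unitInterval → (Space3 ≃ₜ Space3),
    Continuous (fun q : unitInterval × Space3 => H q.1 q.2) ∧
    (∀ x, H 0 x = x) ∧ H 1 '' Γ = Γ'

/-- A polygonal knot: a knot that is a union of finitely many closed straight segments. -/
def IsPolygonalKnot (Γ : Set Space3) : Prop :=
  IsKnot Γ ∧ ∃ s : Finset (Space3 × Space3), Γ = ⋃ e ∈ s, segment ℝ e.1 e.2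

/-- A tame knot: a knot whose ambient isotopy class contains a polygonal knot. -/
def IsTameKnot (Γ : Set Space3) : Prop :=
  IsKnot Γ ∧ ∃ P, IsPolygonalKnot P ∧ AmbientIsotopic Γ P

/-- A round circle, given by a centre `c`, a vector `n ≠ 0` normal to its plane, and a radius
`r > 0`. -/
def IsRoundCircle (C : Set Space3) : Prop :=
  ∃ (c n : Space3) (r : ℝ), n ≠ 0 ∧ 0 < r ∧ C = {x | dist x c = r ∧ inner ℝ n (x - c) = 0}

/-- A trivial knot: one that is ambient isotopic to a round circle. -/
def IsTrivialKnot (Γ : Set Space3) : Prop :=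
  ∃ C, IsRoundCircle C ∧ AmbientIsotopic Γ C

/-- The cross product of three-space. -/
def crossSpace3 (x y : Space3) : Space3 :=
  WithLp.toLp 2 (crossProduct (WithLp.ofLp x) (WithLp.ofLp y))

/-- The rotation by the angle `φ` about the affine line through `p` with unit direction vector
`e` (which orients the line), by Rodrigues' formula. -/
noncomputable def rotationAbout (p e : Space3) (φ : ℝ) (x : Space3) : Space3 :=
  p + (Real.cos φ • (x - p) + Real.sin φ • crossSpace3 e (x - p)
    + ((1 - Real.cos φ) * inner ℝ e (x - p)) • e)

/-- The set `Γ` has a rotational symmetry with angle `φ` about the axis `v`: here `v` is the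
affine line through some point `p` with some unit direction vector `e`, and the rotation by `φ`
about this line maps `Γ` onto itself. (Reversing `e` replaces the rotation by its inverse, so the
condition does not depend on the choice of `p` and `e`.) -/
def HasRotationalSymmetry (Γ : Set Space3) (v : AffineSubspace ℝ Space3) (φ : ℝ) : Prop :=
  ∃ p e : Space3, ‖e‖ = 1 ∧ v = AffineSubspace.mk' p (Submodule.span ℝ {e}) ∧
    rotationAbout p e φ '' Γ = Γ

/-! An isometry `R` mapping the knot onto itself restricts to a homeomorphism of a circle and lifts
to a map `F` of the real line, which is either increasing of degree one or decreasing.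

If `F` is increasing and `R` fixes a point of the curve, then `R` fixes the whole curve: after an
integer shift the orbits of `F` converge monotonically to fixed points, but an isometry keeps the
distance to a fixed point constant (`IsPosLift.eq_add_int`). A closed curve does not fit in a line,
so a nontrivial rotation with increasing lift has no fixed point on the knot. If `F` is decreasing,
it has a fixed point, and `F ∘ F` is increasing with a fixed point, hence the identity; the rotation
is a half turn whose axis meets the knot. This settles the claim about one axis and shows that
rotations of order at least three have increasing lifts.

Any two axes meet, since the circumcentre of the knot is fixed by every symmetry
(`exists_fixed_of_isometry_image`).

Increasing lifts with the same `n`-th iterate, an integer translation, coincide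
(`IsPosLift.eq_of_iterate_eq`). Hence orientation preserving symmetries of finite order commute on
the curve, and a reversing one conjugates them to their inverses. The curve contains enough
directions to carry these relations over to the linear parts in space. Commuting rotations, one of
order at least three, share their axis; a half turn that inverts a rotation has an equal or
perpendicular axis. For axes meeting in one point this excludes two orders at least three, and
forces a half turn paired with such a rotation to reverse the curve. -/

open Filter Topology

/-! ### Closed curves and lifts of their self-maps -/

/-- `c` is a continuous parametrization of a simple closed curve with period exactly `1`. -/
structure IsLoopParam {X : Type*} [TopologicalSpace X] (c : ℝ → X) : Prop where
  cont : Continuous c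
  eq_iff : ∀ x y, c x = c y ↔ ∃ k : ℤ, y = x + k

/-- `F` describes the map `R` in the parameter of the curve `c`. -/
structure IsLift {X : Type*} (c : ℝ → X) (R : X → X) (F : ℝ → ℝ) : Prop where
  cont : Continuous F
  lift : ∀ x, c (F x) = R (c x)

/-- `F` is a lift of `R` that preserves the orientation of the curve `c`. -/
structure IsPosLift {X : Type*} (c : ℝ → X) (R : X → X) (F : ℝ → ℝ) : Prop
    extends IsLift c R F where
  mono : StrictMono F
  add_one : ∀ x, F (x + 1) = F x + 1

/-- A continuous function on `ℝ` with equal values at `0` and `1` takes some value twice on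
`[0, 1)`. -/
theorem exists_eq_of_continuous_of_zero_eq_one {h : ℝ → ℝ} (hc : Continuous h)
    (h01 : h 0 = h 1) : ∃ x y, 0 ≤ x ∧ x < y ∧ y < 1 ∧ h x = h y := by
  rcases lt_trichotomy (h 0) (h (1 / 2)) with hlt | heq | hgt
  · obtain ⟨m, hm⟩ := exists_between hlt
    obtain ⟨x, hx, hxm⟩ := intermediate_value_Ioo (by norm_num : (0 : ℝ) ≤ 1 / 2)
      hc.continuousOn hm
    obtain ⟨y, hy, hym⟩ := intermediate_value_Ioo' (by norm_num : (1 / 2 : ℝ) ≤ 1)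
      hc.continuousOn (show m ∈ Set.Ioo (h 1) (h (1 / 2)) from h01 ▸ hm)
    exact ⟨x, y, hx.1.le, hx.2.trans hy.1, hy.2, hxm.trans hym.symm⟩
  · exact ⟨0, 1 / 2, le_rfl, by norm_num, by norm_num, heq⟩
  · obtain ⟨m, hm⟩ := exists_between hgt
    obtain ⟨x, hx, hxm⟩ := intermediate_value_Ioo' (by norm_num : (0 : ℝ) ≤ 1 / 2)
      hc.continuousOn hm
    obtain ⟨y, hy, hym⟩ := intermediate_value_Ioo (by norm_num : (1 / 2 : ℝ) ≤ 1)
      hc.continuousOn (show m ∈ Set.Ioo (h (1 / 2)) (h 1) from h01 ▸ hm)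
    exact ⟨x, y, hx.1.le, hx.2.trans hy.1, hy.2, hxm.trans hym.symm⟩

/-- A continuous real function with integer values is constant. -/
theorem exists_int_eq_of_continuous {g : ℝ → ℝ} (hg : Continuous g)
    (hZ : ∀ x, ∃ k : ℤ, g x = k) : ∃ k : ℤ, ∀ x, g x = k := by
  obtain ⟨k, hk⟩ := hZ 0
  refine ⟨k, fun x => ?_⟩
  have hp : Set.OrdConnected (Set.range g) := (isPreconnected_range hg).ordConnected
  obtain ⟨m, hm⟩ := hZ x
  have key : ∀ a b : ℤ, (a : ℝ) ∈ Set.range g → (b : ℝ) ∈ Set.range g → ¬ a < b := by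
    intro a b ha hb hab
    have h1 : (a : ℝ) + 1 ≤ b := by exact_mod_cast hab
    obtain ⟨y, hy⟩ := hp.out ha hb (show (a : ℝ) + 1 / 2 ∈ Set.Icc (a : ℝ) b from
      ⟨by linarith, by linarith⟩)
    obtain ⟨n, hn⟩ := hZ y
    rw [hn] at hy
    have h2 : ((2 * n : ℤ) : ℝ) = ((2 * a + 1 : ℤ) : ℝ) := by push_cast; linarith
    have h3 : (2 * n : ℤ) = 2 * a + 1 := by exact_mod_cast h2
    omega
  have h1 := key k m ⟨0, hk⟩ ⟨x, hm⟩
  have h2 := key m k ⟨x, hm⟩ ⟨0, hk⟩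
  rw [hm, le_antisymm (not_lt.1 h1) (not_lt.1 h2)]

section Lift

variable {X : Type*} {c : ℝ → X} {R S : X → X} {F G : ℝ → ℝ}

theorem IsLift.comp (hF : IsLift c R F) (hG : IsLift c S G) : IsLift c (R ∘ S) (F ∘ G) :=
  ⟨hF.cont.comp hG.cont, fun x => by simp [hF.lift, hG.lift]⟩

theorem IsPosLift.comp (hF : IsPosLift c R F) (hG : IsPosLift c S G) :
    IsPosLift c (R ∘ S) (F ∘ G) :=
  ⟨hF.toIsLift.comp hG.toIsLift, hF.mono.comp hG.mono,
    fun x => by simp [hF.add_one, hG.add_one]⟩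

theorem IsPosLift.iterate (hF : IsPosLift c R F) (n : ℕ) : IsPosLift c (R^[n]) (F^[n]) := by
  induction n with
  | zero => exact ⟨⟨continuous_id, fun x => rfl⟩, strictMono_id, fun x => rfl⟩
  | succ n ih =>
    rw [Function.iterate_succ', Function.iterate_succ']
    exact hF.comp ih

theorem add_int_of_add_one {F : ℝ → ℝ} {j : ℝ} (h : ∀ x, F (x + 1) = F x + j) (x : ℝ) (k : ℤ) :
    F (x + k) = F x + k * j := by
  induction k using Int.induction_on with
  | zero => simp
  | succ n ih =>
    push_cast at ih ⊢
    rw [← add_assoc, h, ih]; ring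
  | pred n ih =>
    push_cast at ih ⊢
    have := h (x + (-n - 1))
    rw [show x + (-(n : ℝ) - 1) + 1 = x + -n by ring, ih] at this
    linarith

theorem IsPosLift.add_int (hF : IsPosLift c R F) (x : ℝ) (k : ℤ) : F (x + k) = F x + k := by
  simpa using add_int_of_add_one hF.add_one x k

theorem IsPosLift.surjective (hF : IsPosLift c R F) : Function.Surjective F := by
  intro y
  have h1 : F ((⌊y - F 0⌋ : ℤ) : ℝ) ≤ y := by
    have := hF.add_int 0 ⌊y - F 0⌋
    rw [zero_add] at this
    rw [this]
    linarith [Int.floor_le (y - F 0)]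
  have h2 : y ≤ F ((⌈y - F 0⌉ : ℤ) : ℝ) := by
    have := hF.add_int 0 ⌈y - F 0⌉
    rw [zero_add] at this
    rw [this]
    linarith [Int.le_ceil (y - F 0)]
  exact mem_range_of_exists_le_of_exists_ge hF.cont ⟨_, h1⟩ ⟨_, h2⟩

variable [TopologicalSpace X]

theorem IsLoopParam.add_int (hc : IsLoopParam c) (x : ℝ) (k : ℤ) : c (x + k) = c x :=
  ((hc.eq_iff _ _).2 ⟨k, rfl⟩).symm

theorem IsPosLift.add_const (hc : IsLoopParam c) (hF : IsPosLift c R F) (k : ℤ) :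
    IsPosLift c R (fun x => F (x + k)) := by
  refine ⟨⟨hF.cont.comp (continuous_add_const _), fun x => ?_⟩, fun x y hxy => hF.mono (by simpa),
    fun x => ?_⟩
  · rw [hF.lift, hc.add_int]
  · rw [← hF.add_one]; ring_nf

theorem IsLift.exists_int_of_eqOn (hc : IsLoopParam c) (hF : IsLift c R F)
    (hR : ∀ x, R (c x) = c x) : ∃ k : ℤ, ∀ x, F x = x + k := by
  obtain ⟨k, hk⟩ := exists_int_eq_of_continuous (hF.cont.sub continuous_id) (fun x => by
    obtain ⟨k, hk⟩ := (hc.eq_iff x (F x)).1 ((hF.lift x).trans (hR x)).symm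
    exact ⟨k, by simp [hk]⟩)
  exact ⟨k, fun x => by have := hk x; simp at this; linarith⟩

/-- A lift of an injective map is either orientation preserving or decreasing. -/
theorem IsLift.pos_or_strictAnti (hc : IsLoopParam c) (hR : Function.Injective R)
    (hF : IsLift c R F) :
    IsPosLift c R F ∨ (StrictAnti F ∧ ∃ j : ℤ, ∀ x, F (x + 1) = F x + j) := by
  have hFe : ∀ x y, F x = F y → ∃ k : ℤ, y = x + k := fun x y h =>
    (hc.eq_iff x y).1 (hR (by rw [← hF.lift, ← hF.lift, h]))
  obtain ⟨j, hj⟩ := exists_int_eq_of_continuous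
    ((hF.cont.comp (continuous_add_const 1)).sub hF.cont) (fun x => by
      have h : c (F x) = c (F (x + 1)) := by
        rw [hF.lift, hF.lift]; congr 1; exact (hc.eq_iff _ _).2 ⟨1, by simp⟩
      obtain ⟨k, hk⟩ := (hc.eq_iff _ _).1 h
      exact ⟨k, by simp [hk]⟩)
  have hj : ∀ x, F (x + 1) = F x + j := fun x => by
    have := hj x; simp at this; linarith
  -- In degree zero `F` would take some value twice within a single period, against injectivity
  -- modulo `1`.
  have hj0 : (j : ℝ) ≠ 0 := by
    intro h0
    obtain ⟨x, y, hx, hxy, hy, he⟩ := exists_eq_of_continuous_of_zero_eq_one hF.cont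
      (by have := hj 0; simp [h0] at this; exact this.symm)
    obtain ⟨k, hk⟩ := hFe x y he
    have h1 : (0 : ℝ) < k := by linarith
    have h2 : (k : ℝ) < 1 := by linarith
    norm_cast at h1 h2
    omega
  have hinj : Function.Injective F := by
    intro x y h
    obtain ⟨k, hk⟩ := hFe x y h
    rw [hk, add_int_of_add_one hj] at h
    have : (k : ℝ) * j = 0 := by linarith
    rcases mul_eq_zero.1 this with h | h
    · simp [hk, h]
    · exact absurd h hj0
  rcases hF.cont.strictMono_of_inj hinj with hm | hm
  · left
    refine ⟨hF, hm, fun x => ?_⟩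
    have h1 : (0 : ℝ) < j := by have := hm (show (0 : ℝ) < 0 + 1 by norm_num); rw [hj] at this; linarith
    have h1' : 1 ≤ j := by norm_cast at h1
    by_contra hne
    have h2 : j ≠ 1 := by rintro rfl; exact hne (by rw [hj]; simp)
    have h3 : (1 : ℝ) < j := by
      have : 1 < j := lt_of_le_of_ne h1' (Ne.symm h2)
      exact_mod_cast this
    -- In degree above one the value `F 0 + 1` is attained strictly inside the period, so `R`
    -- identifies two distinct points of the curve.
    obtain ⟨y, hy, hye⟩ := intermediate_value_Ioo (show (0 : ℝ) ≤ 1 by norm_num)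
      hF.cont.continuousOn (show F 0 + 1 ∈ Set.Ioo (F 0) (F 1) by
        have := hj 0
        rw [zero_add] at this
        rw [this]; constructor <;> linarith)
    have h4 : c 0 = c y := hR (by
      rw [← hF.lift, ← hF.lift, hye]; exact (hc.eq_iff _ _).2 ⟨1, by simp⟩)
    obtain ⟨k, hk⟩ := (hc.eq_iff _ _).1 h4
    rw [zero_add] at hk
    rw [hk] at hy
    have h5 := hy.1
    have h6 := hy.2
    norm_cast at h5 h6
    omega
  · exact Or.inr ⟨hm, j, hj⟩

end Lift

/-! ### Isometries of a closed curve -/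

section Isometry

variable {X : Type*} [MetricSpace X] {c : ℝ → X} {R S : X → X} {F G : ℝ → ℝ}

theorem Isometry.iterate' (hR : Isometry R) (n : ℕ) : Isometry (R^[n]) := by
  induction n with
  | zero => exact isometry_id
  | succ n ih => exact ih.comp hR

/-- An orientation preserving lift of an isometry that has a fixed point modulo `1` is a
translation by an integer. -/
theorem IsPosLift.eq_add_int (hc : IsLoopParam c) (hR : Isometry R) (hF : IsPosLift c R F)
    {x₀ : ℝ} {k : ℤ} (h₀ : F x₀ = x₀ + k) (x : ℝ) : F x = x + k := by
  -- Shifting by `-k` makes `x₀` an actual fixed point; its integer translates are then fixed too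
  -- and bound every orbit of `G`.
  set G : ℝ → ℝ := fun x => F (x + (-k : ℤ)) with hGdef
  have hG : IsPosLift c R G := hF.add_const hc _
  have hGF : ∀ y, G y = F y - k := fun y => by
    rw [hGdef]
    beta_reduce
    rw [hF.add_int]
    push_cast
    ring
  have hG₀ : G x₀ = x₀ := by rw [hGF, h₀]; ring
  suffices h : G x = x by
    rw [hGF] at h
    linarith
  have hG₀' : ∀ m : ℤ, G (x₀ + m) = x₀ + m := fun m => by rw [hG.add_int, hG₀]
  have key : ∀ y, Tendsto (fun n => G^[n] x) atTop (𝓝 y) → G x = x := by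
    intro y hy
    have hyfix : G y = y := isFixedPt_of_tendsto_iterate hy hG.cont.continuousAt
    have hRy : R (c y) = c y := by rw [← hG.lift, hyfix]
    have hconst : ∀ n, dist (c (G^[n] x)) (c y) = dist (c x) (c y) := by
      intro n
      rw [(hG.iterate n).lift]
      conv_lhs => rw [← Function.iterate_fixed hRy n]
      exact (hR.iterate' n).dist_eq _ _
    have hlim : Tendsto (fun n => dist (c (G^[n] x)) (c y)) atTop (𝓝 (dist (c y) (c y))) :=
      (((hc.cont.tendsto y).comp hy).dist tendsto_const_nhds)
    simp only [hconst, dist_self] at hlim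
    have h0 : dist (c x) (c y) = 0 := tendsto_nhds_unique tendsto_const_nhds hlim
    obtain ⟨m, hm⟩ := (hc.eq_iff _ _).1 (dist_eq_zero.1 h0)
    rw [hm, hG.add_int] at hyfix
    linarith
  have hmono : Monotone G := hG.mono.monotone
  rcases le_total x (G x) with hx | hx
  · have hb : BddAbove (Set.range fun n => G^[n] x) := by
      refine ⟨x₀ + ⌈x - x₀⌉, ?_⟩
      rintro _ ⟨n, rfl⟩
      have h1 : x ≤ x₀ + ⌈x - x₀⌉ := by linarith [Int.le_ceil (x - x₀)]
      have h2 := hmono.iterate n h1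
      rwa [Function.iterate_fixed (hG₀' _)] at h2
    exact key _ (tendsto_atTop_ciSup (hmono.monotone_iterate_of_le_map hx) hb)
  · have hb : BddBelow (Set.range fun n => G^[n] x) := by
      refine ⟨x₀ + ⌊x - x₀⌋, ?_⟩
      rintro _ ⟨n, rfl⟩
      have h1 : x₀ + ⌊x - x₀⌋ ≤ x := by linarith [Int.floor_le (x - x₀)]
      have h2 := hmono.iterate n h1
      rwa [Function.iterate_fixed (hG₀' _)] at h2
    exact key _ (tendsto_atTop_ciInf (hmono.antitone_iterate_of_map_le hx) hb)

theorem IsPosLift.eqOn_of_fixed (hc : IsLoopParam c) (hR : Isometry R) (hF : IsPosLift c R F)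
    {x₀ : ℝ} (h₀ : R (c x₀) = c x₀) (x : ℝ) : R (c x) = c x := by
  obtain ⟨k, hk⟩ := (hc.eq_iff _ _).1 ((hF.lift x₀).trans h₀).symm
  rw [← hF.lift, hF.eq_add_int hc hR hk, hc.add_int]

/-- A decreasing lift of an isometry is an involution with a fixed point. -/
theorem IsLift.involutive_of_strictAnti (hc : IsLoopParam c) (hR : Isometry R)
    (hF : IsLift c R F) (hanti : StrictAnti F) :
    (∃ x, F x = x) ∧ ∀ x, F (F x) = x := by
  have hfix : ∃ x, F x = x := by
    have hcont : Continuous fun x => F x - x := hF.cont.sub continuous_id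
    have h0 : (0 : ℝ) ∈ Set.range fun x => F x - x := by
      -- The displacement `F x - x` has opposite signs at `0` and at `F 0`, because `F` reverses
      -- order.
      rcases le_total (F 0) 0 with h | h
      · exact mem_range_of_exists_le_of_exists_ge hcont ⟨0, by simpa⟩
          ⟨F 0, sub_nonneg.2 (hanti.antitone h)⟩
      · exact mem_range_of_exists_le_of_exists_ge hcont
          ⟨F 0, sub_nonpos.2 (hanti.antitone h)⟩ ⟨0, by simpa⟩
    obtain ⟨x, hx⟩ := h0
    exact ⟨x, sub_eq_zero.1 hx⟩
  obtain ⟨x₀, hx₀⟩ := hfix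
  refine ⟨⟨x₀, hx₀⟩, fun x => ?_⟩
  have hmono : StrictMono (F ∘ F) := fun a b h => hanti (hanti h)
  have hpos : IsPosLift c (R ∘ R) (F ∘ F) := by
    rcases (hF.comp hF).pos_or_strictAnti hc (hR.comp hR).injective with h | h
    · exact h
    · exact absurd (h.1 zero_lt_one) (hmono zero_lt_one).not_gt
  have h1 : (F ∘ F) x₀ = x₀ + (0 : ℤ) := by simp [hx₀]
  simpa using hpos.eq_add_int hc (hR.comp hR) h1 x

theorem iterate_lt_iterate_of_lt (hG : StrictMono G) (h : ∀ x, F x < G x) {n : ℕ} (hn : n ≠ 0)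
    (x : ℝ) : F^[n] x < G^[n] x := by
  obtain ⟨m, rfl⟩ := Nat.exists_eq_succ_of_ne_zero hn
  clear hn
  induction m with
  | zero => exact h x
  | succ m ih =>
    rw [Function.iterate_succ_apply' F, Function.iterate_succ_apply' G]
    exact (h _).trans (hG ih)

/-- Roots of the same order of an integer translation agree if they are orientation preserving
lifts of isometries. -/
theorem IsPosLift.eq_of_iterate_eq (hc : IsLoopParam c) (hR : Isometry R) (hS : Isometry S)
    (hF : IsPosLift c R F) (hG : IsPosLift c S G) {n : ℕ} (hn : n ≠ 0) {k : ℤ}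
    (hFn : ∀ x, F^[n] x = x + k) (hGn : ∀ x, G^[n] x = x + k) : F = G := by
  by_cases hex : ∃ x₀, F x₀ = G x₀
  · obtain ⟨x₀, h₀⟩ := hex
    obtain ⟨m, rfl⟩ := Nat.exists_eq_succ_of_ne_zero hn
    -- Up to an integer translation `G^[m]` inverts `G`, so `G^[m] ∘ F` is a lift with a fixed point
    -- modulo `1`.
    have hGm : ∀ x, G^[m] (G x) = x + k := fun x => by
      rw [← Function.iterate_succ_apply, hGn]
    have hcomp := (hG.iterate m).comp hF
    have h1 : (G^[m] ∘ F) x₀ = x₀ + k := by simp [h₀, hGm]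
    funext x
    have h2 := hcomp.eq_add_int hc ((hS.iterate' m).comp hR) h1 x
    exact (hG.iterate m).mono.injective (h2.trans (hGm x).symm)
  · exfalso
    push Not at hex
    have hcont : Continuous fun x => F x - G x := hF.cont.sub hG.cont
    have hne : (0 : ℝ) ∉ Set.range fun x => F x - G x := by
      rintro ⟨x, hx⟩
      exact hex x (sub_eq_zero.1 hx)
    rcases lt_or_gt_of_ne (hex 0) with h0 | h0
    · have : ∀ x, F x < G x := by
        intro x
        by_contra hx
        exact hne (mem_range_of_exists_le_of_exists_ge hcont ⟨0, by simpa using h0.le⟩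
          ⟨x, by simpa using hx⟩)
      have := iterate_lt_iterate_of_lt hG.mono this hn 0
      rw [hFn, hGn] at this
      exact lt_irrefl _ this
    · have : ∀ x, G x < F x := by
        intro x
        by_contra hx
        exact hne (mem_range_of_exists_le_of_exists_ge hcont ⟨x, by simpa using hx⟩
          ⟨0, by simpa using h0.le⟩)
      have := iterate_lt_iterate_of_lt hF.mono this hn 0
      rw [hFn, hGn] at this
      exact lt_irrefl _ this

/-- An orientation preserving lift of finite order modulo translations has an inverse that lifts
a power. -/
theorem IsPosLift.exists_inverse (hc : IsLoopParam c) (hF : IsPosLift c R F) {n : ℕ} (hn : n ≠ 0)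
    {k : ℤ} (hFn : ∀ x, F^[n] x = x + k) :
    ∃ F' : ℝ → ℝ, IsPosLift c (R^[n - 1]) F' ∧ (∀ x, F (F' x) = x) ∧ ∀ x, F' (F x) = x := by
  obtain ⟨m, rfl⟩ := Nat.exists_eq_succ_of_ne_zero hn
  refine ⟨_, (hF.iterate m).add_const hc (-k), fun x => ?_, fun x => ?_⟩
  · rw [← Function.iterate_succ_apply' F, hFn]; simp
  · rw [(hF.iterate m).add_int, ← Function.iterate_succ_apply, hFn]; simp

/-- Orientation preserving isometries of finite order of a closed curve commute. -/
theorem IsPosLift.comm (hc : IsLoopParam c) (hR : Isometry R) (hS : Isometry S)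
    (hF : IsPosLift c R F) (hG : IsPosLift c S G) {m n : ℕ} (hm : m ≠ 0) (hn : n ≠ 0)
    (hRm : ∀ x, R^[m] (c x) = c x) (hSn : ∀ x, S^[n] (c x) = c x) (x : ℝ) :
    R (S (c x)) = S (R (c x)) := by
  obtain ⟨j, hj⟩ := (hF.iterate m).exists_int_of_eqOn hc hRm
  obtain ⟨k, hk⟩ := (hG.iterate n).exists_int_of_eqOn hc hSn
  obtain ⟨F', hF', hFF', hF'F⟩ := hF.exists_inverse hc hm hj
  have hH := hF.comp (hG.comp hF')
  have hsemi : Function.Semiconj F G (F ∘ G ∘ F') := fun x => by simp [hF'F]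
  -- Conjugation by `F` keeps the translation by `k`, since `F` commutes with integer translations.
  have hHn : ∀ x, (F ∘ G ∘ F')^[n] x = x + k := by
    intro y
    obtain ⟨x, rfl⟩ := hF.surjective y
    rw [← (hsemi.iterate_right n).eq x, hk, hF.add_int]
  have heq := hH.eq_of_iterate_eq hc (hR.comp (hS.comp (hR.iterate' _))) hS hG hn hHn hk
  have := hsemi.eq x
  rw [heq] at this
  rw [← hG.lift, ← hF.lift, this, hG.lift, hF.lift]

/-- An orientation reversing isometry of a closed curve conjugates orientation preserving ones
of finite order to their inverses. -/
theorem IsPosLift.conj_of_strictAnti (hc : IsLoopParam c) (hR : Isometry R) (hS : Isometry S)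
    (hF : IsLift c R F) (hanti : StrictAnti F) (hG : IsPosLift c S G) {n : ℕ} (hn : n ≠ 0)
    (hSn : ∀ x, S^[n] (c x) = c x) (x : ℝ) :
    S (R (S (c x))) = R (c x) := by
  obtain ⟨k, hk⟩ := (hG.iterate n).exists_int_of_eqOn hc hSn
  obtain ⟨G', hG', hGG', hG'G⟩ := hG.exists_inverse hc hn hk
  have hFF := (hF.involutive_of_strictAnti hc hR hanti).2
  obtain ⟨j, hj⟩ : ∃ j : ℤ, ∀ x, F (x + 1) = F x + j := by
    rcases hF.pos_or_strictAnti hc hR.injective with h | h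
    · exact absurd (h.mono zero_lt_one) (hanti zero_lt_one).not_gt
    · exact h.2
  -- Applying the involution `F` twice to a shift by one gives `j * j = 1`, and `j` is negative.
  have hj1 : (j : ℝ) = -1 := by
    have h1 := hFF (0 + 1)
    rw [hj, add_int_of_add_one hj, hFF] at h1
    have h2 : (j : ℝ) < 0 := by
      have := hanti (show (0 : ℝ) < 0 + 1 by norm_num)
      rw [hj] at this
      linarith
    nlinarith
  have hmono : StrictMono (F ∘ G ∘ F) := fun a b h => hanti (hG.mono (hanti h))
  have hH : IsPosLift c (R ∘ S ∘ R) (F ∘ G ∘ F) := by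
    rcases (hF.comp (hG.toIsLift.comp hF)).pos_or_strictAnti hc
      (hR.comp (hS.comp hR)).injective with h | h
    · exact h
    · exact absurd (h.1 zero_lt_one) (hmono zero_lt_one).not_gt
  have hsemi : Function.Semiconj F G (F ∘ G ∘ F) := fun x => by simp [hFF]
  -- A decreasing `F` reverses integer translations, so the conjugate of `G` has the same `n`-th
  -- iterate as the inverse `G'`.
  have hHn : ∀ x, (F ∘ G ∘ F)^[n] x = x + (-k : ℤ) := by
    intro y
    have h1 := (hsemi.iterate_right n).eq (F y)
    rw [hk, hFF, add_int_of_add_one hj, hFF, hj1] at h1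
    rw [← h1]
    push_cast
    ring
  have hG'n : ∀ x, G'^[n] x = x + (-k : ℤ) := by
    intro x
    have h1 := (Function.LeftInverse.iterate (f := G) (g := G') hG'G n) (x + (-k : ℤ))
    rw [hk] at h1
    simpa using h1
  have heq := hH.eq_of_iterate_eq hc (hR.comp (hS.comp hR)) (hS.iterate' _) hG' hn hHn hG'n
  have h1 : F (G (F (F x))) = G' (F x) := congrFun heq (F x)
  rw [hFF] at h1
  have h2 : G (F (G x)) = F x := by rw [h1, hGG']
  rw [← hG.lift, ← hF.lift, ← hG.lift, h2, hF.lift]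

end Isometry

/-! ### Lifting from the circle to the line -/

/-- A homeomorphism of a closed curve lifts to the real line. -/
theorem exists_isLift {X : Type*} [TopologicalSpace X] [T2Space X] {γ : AddCircle (1 : ℝ) → X}
    (hγ : Continuous γ) (hinj : Function.Injective γ) {R : X → X} (hR : Continuous R)
    (hmaps : R '' Set.range γ = Set.range γ) :
    ∃ F, IsLift (fun x : ℝ => γ x) R F := by
  have : Fact ((0 : ℝ) < 1) := ⟨zero_lt_one⟩
  have hemb : IsClosedEmbedding γ := hγ.isClosedEmbedding hinj
  have hmem : ∀ x : ℝ, R (γ x) ∈ Set.range γ := fun x => hmaps ▸ ⟨_, ⟨_, rfl⟩, rfl⟩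
  choose f hf using hmem
  have hfc : Continuous f := by
    rw [hemb.isInducing.continuous_iff]
    have : γ ∘ f = fun x : ℝ => R (γ x) := funext hf
    rw [this]
    exact hR.comp (hγ.comp (AddCircle.continuous_mk' 1))
  obtain ⟨e₀, he₀⟩ := QuotientAddGroup.mk_surjective (f 0)
  obtain ⟨F, hF, -⟩ := (AddCircle.isCoveringMap_coe (1 : ℝ)).existsUnique_continuousMap_lifts
    ⟨f, hfc⟩ 0 e₀ he₀
  refine ⟨F, F.continuous, fun x => ?_⟩
  have := congrFun hF.2 x
  simp only [Function.comp_apply, ContinuousMap.coe_mk] at this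
  rw [this, hf]

theorem isLoopParam_of_injective {X : Type*} [TopologicalSpace X] {γ : AddCircle (1 : ℝ) → X}
    (hγ : Continuous γ) (hinj : Function.Injective γ) : IsLoopParam (fun x : ℝ => γ x) := by
  refine ⟨hγ.comp (AddCircle.continuous_mk' 1), fun x y => ?_⟩
  rw [hinj.eq_iff, eq_comm, QuotientAddGroup.eq_iff_sub_mem, AddSubgroup.mem_zmultiples_iff]
  simp only [zsmul_eq_mul, mul_one]
  exact exists_congr fun k => ⟨fun h => by linarith, fun h => by linarith⟩

/-! ### The cross product and rotations in coordinates -/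

theorem crossSpace3_zero_apply (x y : Space3) :
    crossSpace3 x y 0 = x 1 * y 2 - x 2 * y 1 := by
  simp [crossSpace3, cross_apply]

theorem crossSpace3_one_apply (x y : Space3) :
    crossSpace3 x y 1 = x 2 * y 0 - x 0 * y 2 := by
  simp [crossSpace3, cross_apply]

theorem crossSpace3_two_apply (x y : Space3) :
    crossSpace3 x y 2 = x 0 * y 1 - x 1 * y 0 := by
  simp [crossSpace3, cross_apply]

theorem inner_space3 (x y : Space3) : inner ℝ x y = x 0 * y 0 + x 1 * y 1 + x 2 * y 2 := by
  simp [PiLp.inner_apply, Fin.sum_univ_three, mul_comm]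

theorem Space3.ext {x y : Space3} (h0 : x 0 = y 0) (h1 : x 1 = y 1) (h2 : x 2 = y 2) : x = y := by
  ext i
  fin_cases i <;> assumption

theorem Space3.norm_eq_one_iff (e : Space3) :
    ‖e‖ = 1 ↔ e 0 * e 0 + e 1 * e 1 + e 2 * e 2 = 1 := by
  rw [← inner_space3, real_inner_self_eq_norm_sq, pow_eq_one_iff_of_nonneg (norm_nonneg e) two_ne_zero]

/-- The linear part of the rotation `rotationAbout p e φ`. -/
noncomputable def rotationLinear (e : Space3) (φ : ℝ) : Space3 →ₗ[ℝ] Space3 where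
  toFun x := Real.cos φ • x + Real.sin φ • crossSpace3 e x
    + ((1 - Real.cos φ) * inner ℝ e x) • e
  map_add' x y := by
    apply Space3.ext <;>
      simp [crossSpace3_zero_apply, crossSpace3_one_apply, crossSpace3_two_apply, inner_space3] <;>
      ring
  map_smul' t x := by
    apply Space3.ext <;>
      simp [crossSpace3_zero_apply, crossSpace3_one_apply, crossSpace3_two_apply, inner_space3] <;>
      ring

theorem rotationLinear_apply (e : Space3) (φ : ℝ) (x : Space3) :
    rotationLinear e φ x = Real.cos φ • x + Real.sin φ • crossSpace3 e x
      + ((1 - Real.cos φ) * inner ℝ e x) • e := rfl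

theorem rotationLinear_coord_zero (e : Space3) (φ : ℝ) (x : Space3) :
    rotationLinear e φ x 0 = Real.cos φ * x 0 + Real.sin φ * (e 1 * x 2 - e 2 * x 1)
      + (1 - Real.cos φ) * (e 0 * x 0 + e 1 * x 1 + e 2 * x 2) * e 0 := by
  simp [rotationLinear_apply, crossSpace3_zero_apply, inner_space3]

theorem rotationLinear_coord_one (e : Space3) (φ : ℝ) (x : Space3) :
    rotationLinear e φ x 1 = Real.cos φ * x 1 + Real.sin φ * (e 2 * x 0 - e 0 * x 2)
      + (1 - Real.cos φ) * (e 0 * x 0 + e 1 * x 1 + e 2 * x 2) * e 1 := by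
  simp [rotationLinear_apply, crossSpace3_one_apply, inner_space3]

theorem rotationLinear_coord_two (e : Space3) (φ : ℝ) (x : Space3) :
    rotationLinear e φ x 2 = Real.cos φ * x 2 + Real.sin φ * (e 0 * x 1 - e 1 * x 0)
      + (1 - Real.cos φ) * (e 0 * x 0 + e 1 * x 1 + e 2 * x 2) * e 2 := by
  simp [rotationLinear_apply, crossSpace3_two_apply, inner_space3]

theorem rotationAbout_eq (p e : Space3) (φ : ℝ) (x : Space3) :
    rotationAbout p e φ x = p + rotationLinear e φ (x - p) := rfl

theorem rotationAbout_sub (p e : Space3) (φ : ℝ) (x : Space3) :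
    rotationAbout p e φ x - p = rotationLinear e φ (x - p) := by
  rw [rotationAbout_eq, add_sub_cancel_left]

section Rotation

variable {e : Space3} (he : ‖e‖ = 1)
include he

theorem norm_rotationLinear (φ : ℝ) (x : Space3) : ‖rotationLinear e φ x‖ = ‖x‖ := by
  rw [Space3.norm_eq_one_iff] at he
  have hcs := Real.sin_sq_add_cos_sq φ
  rw [← sq_eq_sq₀ (norm_nonneg _) (norm_nonneg _), ← real_inner_self_eq_norm_sq,
    ← real_inner_self_eq_norm_sq, inner_space3, inner_space3, rotationLinear_coord_zero,
    rotationLinear_coord_one, rotationLinear_coord_two]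
  linear_combination (he) * (Real.sin φ ^ 2 * (x 0 * x 0 + x 1 * x 1 + x 2 * x 2) +
      (1 - Real.cos φ) ^ 2 * (e 0 * x 0 + e 1 * x 1 + e 2 * x 2) ^ 2) +
    hcs * ((x 0 * x 0 + x 1 * x 1 + x 2 * x 2) - (e 0 * x 0 + e 1 * x 1 + e 2 * x 2) ^ 2)

theorem rotationLinear_rotationLinear (φ ψ : ℝ) (x : Space3) :
    rotationLinear e φ (rotationLinear e ψ x) = rotationLinear e (φ + ψ) x := by
  rw [Space3.norm_eq_one_iff] at he
  apply Space3.ext <;>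
    simp only [rotationLinear_coord_zero, rotationLinear_coord_one, rotationLinear_coord_two,
      Real.cos_add, Real.sin_add]
  · linear_combination he * (-(Real.sin φ * Real.sin ψ * x 0) + (1 - Real.cos φ) *
      (1 - Real.cos ψ) * (e 0 * x 0 + e 1 * x 1 + e 2 * x 2) * e 0)
  · linear_combination he * (-(Real.sin φ * Real.sin ψ * x 1) + (1 - Real.cos φ) *
      (1 - Real.cos ψ) * (e 0 * x 0 + e 1 * x 1 + e 2 * x 2) * e 1)
  · linear_combination he * (-(Real.sin φ * Real.sin ψ * x 2) + (1 - Real.cos φ) *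
      (1 - Real.cos ψ) * (e 0 * x 0 + e 1 * x 1 + e 2 * x 2) * e 2)

/-- Rotations are orthogonal of determinant one. Preservation of the cross product is what later
lets two vectors determine the linear part. -/
theorem rotationLinear_cross (φ : ℝ) (x y : Space3) :
    rotationLinear e φ (crossSpace3 x y) =
      crossSpace3 (rotationLinear e φ x) (rotationLinear e φ y) := by
  rw [Space3.norm_eq_one_iff] at he
  have hcs := Real.sin_sq_add_cos_sq φ
  apply Space3.ext <;>
    simp only [rotationLinear_coord_zero, rotationLinear_coord_one, rotationLinear_coord_two,
      crossSpace3_zero_apply, crossSpace3_one_apply, crossSpace3_two_apply] <;>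
    generalize Real.cos φ = c at * <;> generalize Real.sin φ = s at *
  · linear_combination -he * (c * (1 - c) * (x 1 * y 2 - x 2 * y 1) + s * (1 - c) *
      (e 1 * (x 0 * y 1 - x 1 * y 0) - e 2 * (x 2 * y 0 - x 0 * y 2))) -
      hcs * e 0 * (e 0 * (x 1 * y 2 - x 2 * y 1) + e 1 * (x 2 * y 0 - x 0 * y 2) +
        e 2 * (x 0 * y 1 - x 1 * y 0))
  · linear_combination -he * (c * (1 - c) * (x 2 * y 0 - x 0 * y 2) + s * (1 - c) *
      (e 2 * (x 1 * y 2 - x 2 * y 1) - e 0 * (x 0 * y 1 - x 1 * y 0))) -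
      hcs * e 1 * (e 0 * (x 1 * y 2 - x 2 * y 1) + e 1 * (x 2 * y 0 - x 0 * y 2) +
        e 2 * (x 0 * y 1 - x 1 * y 0))
  · linear_combination -he * (c * (1 - c) * (x 0 * y 1 - x 1 * y 0) + s * (1 - c) *
      (e 0 * (x 2 * y 0 - x 0 * y 2) - e 1 * (x 1 * y 2 - x 2 * y 1))) -
      hcs * e 2 * (e 0 * (x 1 * y 2 - x 2 * y 1) + e 1 * (x 2 * y 0 - x 0 * y 2) +
        e 2 * (x 0 * y 1 - x 1 * y 0))

theorem rotationLinear_self (φ : ℝ) : rotationLinear e φ e = e := by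
  rw [Space3.norm_eq_one_iff] at he
  apply Space3.ext <;>
    simp only [rotationLinear_coord_zero, rotationLinear_coord_one, rotationLinear_coord_two]
  · linear_combination he * (1 - Real.cos φ) * e 0
  · linear_combination he * (1 - Real.cos φ) * e 1
  · linear_combination he * (1 - Real.cos φ) * e 2

/-- The fixed vectors of a nontrivial rotation lie on its axis. -/
theorem eq_smul_of_rotationLinear_eq {φ : ℝ} (hφ : Real.cos φ ≠ 1) {x : Space3}
    (h : rotationLinear e φ x = x) : x = (inner ℝ e x : ℝ) • e := by
  rw [Space3.norm_eq_one_iff] at he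
  have h0 := rotationLinear_coord_zero e φ x
  have h1 := rotationLinear_coord_one e φ x
  have h2 := rotationLinear_coord_two e φ x
  rw [h] at h0 h1 h2
  -- Pairing the fixed-vector equation with `x` kills the cross product term and leaves equality in
  -- Cauchy–Schwarz for `e` and `x`.
  have hX : (1 - Real.cos φ) * ((x 0 * x 0 + x 1 * x 1 + x 2 * x 2) -
      (e 0 * x 0 + e 1 * x 1 + e 2 * x 2) ^ 2) = 0 := by
    linear_combination h0 * x 0 + h1 * x 1 + h2 * x 2
  have hX' := (mul_eq_zero.1 hX).resolve_left (sub_ne_zero.2 hφ.symm)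
  rw [← sub_eq_zero, ← inner_self_eq_zero (𝕜 := ℝ), inner_space3]
  simp only [PiLp.sub_apply, PiLp.smul_apply, smul_eq_mul, inner_space3]
  linear_combination hX' + he * (e 0 * x 0 + e 1 * x 1 + e 2 * x 2) ^ 2

theorem isometry_rotationAbout (p : Space3) (φ : ℝ) : Isometry (rotationAbout p e φ) := by
  refine Isometry.of_dist_eq fun x y => ?_
  rw [dist_eq_norm, rotationAbout_eq, rotationAbout_eq, add_sub_add_left_eq_sub, ← map_sub,
    norm_rotationLinear he, sub_sub_sub_cancel_right, dist_eq_norm]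

theorem iterate_rotationAbout (p : Space3) (φ : ℝ) (n : ℕ) (x : Space3) :
    (rotationAbout p e φ)^[n] x = rotationAbout p e (n * φ) x := by
  induction n with
  | zero => simp [rotationAbout]
  | succ n ih =>
    rw [Function.iterate_succ_apply', ih, rotationAbout_eq, rotationAbout_sub,
      rotationLinear_rotationLinear he, rotationAbout_eq]
    congr 3
    push_cast
    ring

theorem rotationAbout_add_smul (p : Space3) (t φ : ℝ) :
    rotationAbout (p + t • e) e φ = rotationAbout p e φ := by
  funext x
  rw [rotationAbout_eq, rotationAbout_eq, ← sub_sub, map_sub, map_smul, rotationLinear_self he]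
  abel

theorem exists_eq_add_smul_of_rotationAbout_eq {p x : Space3} {φ : ℝ} (hφ : Real.cos φ ≠ 1)
    (h : rotationAbout p e φ x = x) : ∃ t : ℝ, x = p + t • e := by
  refine ⟨inner ℝ e (x - p), ?_⟩
  rw [← eq_smul_of_rotationLinear_eq he hφ (x := x - p) (by rw [← rotationAbout_sub, h])]
  abel

end Rotation

/-! ### Axes, and linear maps preserving the cross product -/

theorem mem_axis_iff {p e x : Space3} :
    x ∈ AffineSubspace.mk' p (Submodule.span ℝ {e}) ↔ ∃ t : ℝ, x = p + t • e := by
  rw [AffineSubspace.mem_mk', Submodule.mem_span_singleton]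
  exact exists_congr fun t => by rw [vsub_eq_sub, eq_sub_iff_add_eq', eq_comm]

/-- Rotations about two axes through `p` can thus both be based at `p`, and only their linear parts
need comparing. -/
theorem HasRotationalSymmetry.exists_of_mem {Γ : Set Space3} {v : AffineSubspace ℝ Space3} {φ : ℝ}
    (h : HasRotationalSymmetry Γ v φ) {p : Space3} (hp : p ∈ v) :
    ∃ e : Space3, ‖e‖ = 1 ∧ v = AffineSubspace.mk' p (Submodule.span ℝ {e}) ∧
      rotationAbout p e φ '' Γ = Γ := by
  obtain ⟨q, e, he, rfl, hΓ⟩ := h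
  obtain ⟨t, rfl⟩ := mem_axis_iff.1 hp
  refine ⟨e, he, ?_, by rwa [rotationAbout_add_smul he]⟩
  have := AffineSubspace.mk'_eq hp
  rw [AffineSubspace.direction_mk'] at this
  exact this.symm

/-- Cramer's rule for the vectors `x`, `y`, `x × y`, whose determinant is the squared length of `x ×
y`. -/
theorem inner_self_smul_eq_of_cross (x y z : Space3) :
    (inner ℝ (crossSpace3 x y) (crossSpace3 x y) : ℝ) • z =
      (inner ℝ z (crossSpace3 y (crossSpace3 x y)) : ℝ) • x +
      (inner ℝ z (crossSpace3 (crossSpace3 x y) x) : ℝ) • y +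
      (inner ℝ z (crossSpace3 x y) : ℝ) • crossSpace3 x y := by
  apply Space3.ext <;>
    simp only [PiLp.add_apply, PiLp.smul_apply, smul_eq_mul, inner_space3, crossSpace3_zero_apply,
      crossSpace3_one_apply, crossSpace3_two_apply] <;>
    ring

/-- Two linear maps that preserve the cross product agree if they agree on two linearly
independent vectors. -/
theorem eq_of_cross_of_eq {T T' : Space3 →ₗ[ℝ] Space3}
    (hT : ∀ x y, T (crossSpace3 x y) = crossSpace3 (T x) (T y))
    (hT' : ∀ x y, T' (crossSpace3 x y) = crossSpace3 (T' x) (T' y)) {x y : Space3}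
    (hxy : crossSpace3 x y ≠ 0) (hx : T x = T' x) (hy : T y = T' y) (z : Space3) :
    T z = T' z := by
  have h0 : (inner ℝ (crossSpace3 x y) (crossSpace3 x y) : ℝ) ≠ 0 := inner_self_ne_zero.2 hxy
  have hn : T (crossSpace3 x y) = T' (crossSpace3 x y) := by rw [hT, hT', hx, hy]
  apply smul_right_injective _ h0
  simp only
  rw [← map_smul, ← map_smul, inner_self_smul_eq_of_cross x y z]
  simp only [map_add, map_smul, hx, hy, hn]

theorem exists_eq_smul_of_cross_eq_zero {x y : Space3} (hx : x ≠ 0) (h : crossSpace3 x y = 0) :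
    ∃ t : ℝ, y = t • x := by
  have hX : (inner ℝ x x : ℝ) ≠ 0 := inner_self_ne_zero.2 hx
  have h0 := crossSpace3_zero_apply x y
  have h1 := crossSpace3_one_apply x y
  have h2 := crossSpace3_two_apply x y
  rw [h] at h0 h1 h2
  simp only [PiLp.zero_apply] at h0 h1 h2
  refine ⟨inner ℝ x y / inner ℝ x x, ?_⟩
  have key : (inner ℝ x x : ℝ) • y = (inner ℝ x y : ℝ) • x := by
    apply Space3.ext <;> simp only [PiLp.smul_apply, smul_eq_mul, inner_space3]
    · linear_combination h2 * x 1 - h1 * x 2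
    · linear_combination h0 * x 2 - h2 * x 0
    · linear_combination h1 * x 0 - h0 * x 1
  rw [div_eq_inv_mul, mul_smul, ← key, smul_smul, inv_mul_cancel₀ hX, one_smul]

/-! ### The common fixed point of all symmetries -/

/-- The circumcentre of a nonempty compact set is fixed by all its isometric symmetries. -/
theorem exists_fixed_of_isometry_image {K : Set Space3} (hK : IsCompact K) (hne : K.Nonempty) :
    ∃ z : Space3, ∀ R : Space3 → Space3, Isometry R → R '' K = K → R z = z := by
  set r : Space3 → ℝ := fun z => sSup (dist z '' K) with hr
  have hrc : Continuous r := hK.continuous_sSup (f := fun z x : Space3 => dist z x) continuous_dist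
  have hle : ∀ z, ∀ x ∈ K, dist z x ≤ r z := fun z x hx =>
    le_csSup (hK.image (continuous_const.dist continuous_id)).bddAbove ⟨x, hx, rfl⟩
  have hmax : ∀ z, ∃ x ∈ K, r z = dist z x := fun z => by
    obtain ⟨x, hx, h⟩ := (hK.image (continuous_const.dist continuous_id) :
      IsCompact (dist z '' K)).sSup_mem (hne.image _)
    exact ⟨x, hx, h.symm⟩
  obtain ⟨x₀, hx₀⟩ := hne
  have hlim : Tendsto r (cocompact Space3) atTop :=
    tendsto_atTop_mono (fun z => hle z x₀ hx₀) (tendsto_dist_right_cocompact_atTop x₀)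
  obtain ⟨z, hz⟩ := hrc.exists_forall_le hlim
  refine ⟨z, fun R hR hRK => ?_⟩
  have hrR : r (R z) = r z := by
    simp only [hr]
    congr 1
    conv_lhs => rw [← hRK]
    rw [Set.image_image]
    simp only [hR.dist_eq]
  by_contra hne
  -- If `z` and `R z` were distinct minimizers of `r`, the parallelogram law would make `r` strictly
  -- smaller at their midpoint.
  obtain ⟨x, hx, hmx⟩ := hmax (midpoint ℝ (R z) z)
  have h1 := hz (midpoint ℝ (R z) z)
  have h2 := hle z x hx
  have h3 := hle (R z) x hx
  rw [hrR] at h3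
  rw [hmx] at h1
  have hpar := parallelogram_law_with_norm ℝ (R z - x) (z - x)
  have h4 : R z - x + (z - x) = (2 : ℝ) • (midpoint ℝ (R z) z - x) := by
    rw [midpoint_eq_smul_add, smul_sub, smul_smul]
    norm_num [two_smul]
    abel
  rw [h4, norm_smul, sub_sub_sub_cancel_right] at hpar
  simp only [dist_eq_norm] at h1 h2 h3
  have h5 : 0 < ‖R z - z‖ := norm_pos_iff.2 (sub_ne_zero.2 hne)
  norm_num at hpar
  nlinarith [norm_nonneg (z - x), norm_nonneg (R z - x), norm_nonneg (midpoint ℝ (R z) z - x),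
    dist_nonneg.trans (hle z x hx)]

/-! ### Angles and the relative position of two axes -/

theorem cos_two_pi_div_ne_one {a : ℝ} (ha : 1 < a) : Real.cos (2 * Real.pi / a) ≠ 1 := by
  have hpi := Real.pi_pos
  have h1 : 0 < 2 * Real.pi / a := by positivity
  have h2 : 2 * Real.pi / a < 2 * Real.pi := div_lt_self (by positivity) ha
  rw [Ne, Real.cos_eq_one_iff_of_lt_of_lt (by linarith) h2]
  exact h1.ne'

theorem cos_two_mul_two_pi_div_ne_one {a : ℤ} (ha : 3 ≤ a) :
    Real.cos (2 * (2 * Real.pi / (a : ℝ))) ≠ 1 := by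
  have ha' : (3 : ℝ) ≤ a := by exact_mod_cast ha
  have := cos_two_pi_div_ne_one (a := (a : ℝ) / 2) (by linarith)
  convert this using 2
  field_simp

/-- If `A` is a rotation by an angle other than `0` and `π`, and `A f` lies on the axis
spanned by the unit vector `f`, then the axis of `A` is spanned by `f`. -/
theorem eq_smul_of_rotationLinear_fixed {e f : Space3} (he : ‖e‖ = 1) (hf : ‖f‖ = 1) {φ ψ : ℝ}
    (hφ : Real.cos φ ≠ 1) (hφ2 : Real.cos (2 * φ) ≠ 1) (hψ : Real.cos ψ ≠ 1)
    (h : rotationLinear f ψ (rotationLinear e φ f) = rotationLinear e φ f) :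
    ∃ t : ℝ, f = t • e := by
  have h1 := eq_smul_of_rotationLinear_eq hf hψ h
  have h2 := congrArg norm h1
  rw [norm_rotationLinear he, norm_smul, hf, mul_one, Real.norm_eq_abs] at h2
  rcases eq_or_eq_neg_of_abs_eq h2.symm with h3 | h3
  · rw [h3, one_smul] at h1
    exact ⟨_, eq_smul_of_rotationLinear_eq he hφ h1⟩
  -- Here the rotation sends `f` to `-f`, so its square, still nontrivial, fixes `f`.
  · rw [h3, neg_one_smul] at h1
    refine ⟨_, eq_smul_of_rotationLinear_eq he hφ2 ?_⟩
    rw [two_mul, ← rotationLinear_rotationLinear he, h1, map_neg, h1, neg_neg]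

/-- The hypothesis forces the half turn to send `f` to `f` or `-f`. Since it sends `f` to `2⟨e, f⟩ e
- f`, the second case leaves `⟨e, f⟩ = 0`. -/
theorem eq_smul_or_inner_eq_zero_of_half_turn {e f : Space3} (he : ‖e‖ = 1) (hf : ‖f‖ = 1) {ψ : ℝ}
    (hψ : Real.cos ψ ≠ 1)
    (h : rotationLinear f ψ (rotationLinear e Real.pi f) = rotationLinear e Real.pi f) :
    (∃ t : ℝ, f = t • e) ∨ (inner ℝ e f : ℝ) = 0 := by
  have h1 := eq_smul_of_rotationLinear_eq hf hψ h
  have h2 := congrArg norm h1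
  rw [norm_rotationLinear he, norm_smul, hf, mul_one, Real.norm_eq_abs] at h2
  rcases eq_or_eq_neg_of_abs_eq h2.symm with h3 | h3
  · rw [h3, one_smul] at h1
    exact Or.inl ⟨_, eq_smul_of_rotationLinear_eq he (by norm_num) h1⟩
  · rw [h3, neg_one_smul, rotationLinear_apply, Real.cos_pi, Real.sin_pi] at h1
    right
    have h4 : (2 * inner ℝ e f : ℝ) • e = 0 := by
      have : -f + (2 * inner ℝ e f : ℝ) • e = -f := by
        convert h1 using 1
        norm_num
      simpa using this
    have he0 : e ≠ 0 := by
      rintro rfl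
      simp at he
    simpa [he0] using h4

/-! ### Rotational symmetries of closed space curves -/

section Loop

variable {c : ℝ → Space3} (hc : IsLoopParam c)
include hc

/-- A closed curve is not contained in a line. -/
theorem IsLoopParam.exists_notMem_line (p : Space3) {e : Space3} (he : e ≠ 0) :
    ∃ x, ∀ t : ℝ, c x ≠ p + t • e := by
  by_contra! hline
  have hcont : Continuous fun x => (inner ℝ e (c x - p) : ℝ) :=
    continuous_const.inner (hc.cont.sub continuous_const)
  obtain ⟨x, y, hx, hxy, hy, heq⟩ := exists_eq_of_continuous_of_zero_eq_one hcont
    (by rw [(hc.eq_iff 0 1).2 ⟨1, by simp⟩])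
  obtain ⟨s, hs⟩ := hline x
  obtain ⟨t, ht⟩ := hline y
  simp only [hs, ht, add_sub_cancel_left, inner_smul_right] at heq
  have hst : s = t := mul_right_cancel₀ (inner_self_ne_zero.2 he) heq
  obtain ⟨k, hk⟩ := (hc.eq_iff x y).1 (by rw [hs, ht, hst])
  have h1 : (0 : ℝ) < k := by linarith
  have h2 : (k : ℝ) < 1 := by linarith
  norm_cast at h1 h2
  omega

theorem IsLoopParam.exists_cross_ne_zero (p : Space3) :
    ∃ x y, crossSpace3 (c x - p) (c y - p) ≠ 0 := by
  -- The direction `e` is arbitrary; it only serves to find a point of the curve other than `p`.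
  obtain ⟨e, he⟩ := exists_ne (0 : Space3)
  obtain ⟨x, hx⟩ := hc.exists_notMem_line p he
  have hxp : c x - p ≠ 0 := fun h => hx 0 (by rw [zero_smul, add_zero, sub_eq_zero.1 h])
  obtain ⟨y, hy⟩ := hc.exists_notMem_line p hxp
  refine ⟨x, y, fun h => ?_⟩
  obtain ⟨t, ht⟩ := exists_eq_smul_of_cross_eq_zero hxp h
  exact hy t (by rw [← ht, add_sub_cancel])

/-- Linear maps that preserve the cross product are determined by their values on a closed
curve. -/
theorem IsLoopParam.linearMap_ext (p : Space3) {T T' : Space3 →ₗ[ℝ] Space3}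
    (hT : ∀ x y, T (crossSpace3 x y) = crossSpace3 (T x) (T y))
    (hT' : ∀ x y, T' (crossSpace3 x y) = crossSpace3 (T' x) (T' y))
    (h : ∀ x, T (c x - p) = T' (c x - p)) (z : Space3) : T z = T' z := by
  obtain ⟨x, y, hxy⟩ := hc.exists_cross_ne_zero p
  exact eq_of_cross_of_eq hT hT' hxy (h x) (h y) z

theorem IsLoopParam.cos_eq_one_of_fixed {p e : Space3} (he : ‖e‖ = 1) {φ : ℝ}
    (h : ∀ x, rotationAbout p e φ (c x) = c x) : Real.cos φ = 1 := by
  by_contra hφ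
  have he0 : e ≠ 0 := by
    rintro rfl
    simp at he
  obtain ⟨x, hx⟩ := hc.exists_notMem_line p he0
  obtain ⟨t, ht⟩ := exists_eq_add_smul_of_rotationAbout_eq he hφ (h x)
  exact hx t ht

/-- The square of the rotation fixes the curve pointwise, so the doubled angle is trivial. -/
theorem IsLift.involutive_rotation_of_strictAnti {p e : Space3} (he : ‖e‖ = 1) {φ : ℝ} {F : ℝ → ℝ}
    (hF : IsLift c (rotationAbout p e φ) F) (hanti : StrictAnti F) :
    (∃ x, rotationAbout p e φ (c x) = c x) ∧ Real.cos (2 * φ) = 1 := by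
  obtain ⟨⟨x, hx⟩, hinv⟩ := hF.involutive_of_strictAnti hc (isometry_rotationAbout he p φ) hanti
  refine ⟨⟨x, by rw [← hF.lift, hx]⟩, hc.cos_eq_one_of_fixed (p := p) he fun y => ?_⟩
  have := iterate_rotationAbout he p φ 2 (c y)
  simp only [Function.iterate_succ_apply, Function.iterate_zero_apply] at this
  push_cast at this
  rw [← this, ← hF.lift, ← hF.lift, hinv]

theorem IsPosLift.rotation_ne {p e : Space3} (he : ‖e‖ = 1) {φ : ℝ} (hφ : Real.cos φ ≠ 1)
    {F : ℝ → ℝ} (hF : IsPosLift c (rotationAbout p e φ) F) (x : ℝ) :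
    rotationAbout p e φ (c x) ≠ c x := fun h =>
  hφ (hc.cos_eq_one_of_fixed he (hF.eqOn_of_fixed hc (isometry_rotationAbout he p φ) h))

omit hc in
theorem iterate_rotationAbout_two_pi_div {p e : Space3} (he : ‖e‖ = 1) {a : ℤ} (ha : 2 ≤ a)
    (x : Space3) : (rotationAbout p e (2 * Real.pi / (a : ℝ)))^[a.toNat] x = x := by
  have h1 : ((a.toNat : ℕ) : ℝ) = (a : ℝ) := by
    exact_mod_cast Int.toNat_of_nonneg (show 0 ≤ a by omega)
  have h2 : (a : ℝ) ≠ 0 := by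
    have : a ≠ 0 := by omega
    exact_mod_cast this
  rw [iterate_rotationAbout he, h1, mul_div_cancel₀ _ h2]
  simp [rotationAbout]

/-- Orientation preserving rotational symmetries, not both half turns, have the same axis. -/
theorem IsPosLift.exists_eq_smul {p e f : Space3} (he : ‖e‖ = 1) (hf : ‖f‖ = 1) {a b : ℤ}
    (ha : 3 ≤ a) (hb : 2 ≤ b) {F G : ℝ → ℝ}
    (hF : IsPosLift c (rotationAbout p e (2 * Real.pi / (a : ℝ))) F)
    (hG : IsPosLift c (rotationAbout p f (2 * Real.pi / (b : ℝ))) G) :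
    ∃ t : ℝ, f = t • e := by
  have ha1 : (1 : ℝ) < a := by exact_mod_cast (by omega : 1 < a)
  have hb1 : (1 : ℝ) < b := by exact_mod_cast (by omega : 1 < b)
  have hcomm := hF.comm hc (isometry_rotationAbout he p _) (isometry_rotationAbout hf p _) hG
    (m := a.toNat) (n := b.toNat) (by omega) (by omega)
    (fun x => iterate_rotationAbout_two_pi_div he (by omega) _)
    (fun x => iterate_rotationAbout_two_pi_div hf hb _)
  refine eq_smul_of_rotationLinear_fixed he hf (cos_two_pi_div_ne_one ha1)
    (cos_two_mul_two_pi_div_ne_one ha) (cos_two_pi_div_ne_one hb1) ?_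
  -- Commutation on the curve extends to the linear parts on all of space; evaluated at `f`, it says
  -- that the rotation about `f` fixes the image of `f`.
  have h := hc.linearMap_ext p
    (T := rotationLinear e (2 * Real.pi / (a : ℝ)) ∘ₗ rotationLinear f (2 * Real.pi / (b : ℝ)))
    (T' := rotationLinear f (2 * Real.pi / (b : ℝ)) ∘ₗ rotationLinear e (2 * Real.pi / (a : ℝ)))
    (fun x y => by simp [rotationLinear_cross he, rotationLinear_cross hf])
    (fun x y => by simp [rotationLinear_cross he, rotationLinear_cross hf])
    (fun x => by
      simp only [LinearMap.comp_apply, ← rotationAbout_sub, hcomm]) f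
  simp only [LinearMap.comp_apply, rotationLinear_self hf] at h
  exact h.symm

/-- The axis of an orientation reversing half turn is equal or perpendicular to that of an
orientation preserving rotational symmetry. -/
theorem IsLift.exists_eq_smul_or_inner_eq_zero {p e f : Space3} (he : ‖e‖ = 1) (hf : ‖f‖ = 1)
    {b : ℤ} (hb : 2 ≤ b) {F G : ℝ → ℝ} (hF : IsLift c (rotationAbout p e Real.pi) F)
    (hanti : StrictAnti F)
    (hG : IsPosLift c (rotationAbout p f (2 * Real.pi / (b : ℝ))) G) :
    (∃ t : ℝ, f = t • e) ∨ (inner ℝ e f : ℝ) = 0 := by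
  have hb1 : (1 : ℝ) < b := by exact_mod_cast (by omega : 1 < b)
  have hconj := hG.conj_of_strictAnti hc (isometry_rotationAbout he p _)
    (isometry_rotationAbout hf p _) hF hanti (n := b.toNat) (by omega)
    (fun x => iterate_rotationAbout_two_pi_div hf hb _)
  refine eq_smul_or_inner_eq_zero_of_half_turn he hf (cos_two_pi_div_ne_one hb1) ?_
  have h := hc.linearMap_ext p
    (T := rotationLinear f (2 * Real.pi / (b : ℝ)) ∘ₗ rotationLinear e Real.pi ∘ₗ
      rotationLinear f (2 * Real.pi / (b : ℝ)))
    (T' := rotationLinear e Real.pi)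
    (fun x y => by simp [rotationLinear_cross he, rotationLinear_cross hf])
    (fun x y => rotationLinear_cross he _ _ _)
    (fun x => by
      simp only [LinearMap.comp_apply, ← rotationAbout_sub, hconj]) f
  simpa only [LinearMap.comp_apply, rotationLinear_self hf] using h

end Loop

/-- A rotational symmetry of a closed curve of order at least three preserves the orientation. -/
theorem IsLift.isPosLift_of_three_le {c : ℝ → Space3} (hc : IsLoopParam c) {p e : Space3}
    (he : ‖e‖ = 1) {a : ℤ} (ha : 3 ≤ a) {F : ℝ → ℝ}
    (hF : IsLift c (rotationAbout p e (2 * Real.pi / (a : ℝ))) F) :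
    IsPosLift c (rotationAbout p e (2 * Real.pi / (a : ℝ))) F := by
  rcases hF.pos_or_strictAnti hc (isometry_rotationAbout he p _).injective with h | h
  · exact h
  · exact absurd (hF.involutive_rotation_of_strictAnti hc he h.1).2
      (cos_two_mul_two_pi_div_ne_one ha)

/-! ### Rotational symmetries of knots -/

theorem IsKnot.exists_isLoopParam {Γ : Set Space3} (hΓ : IsKnot Γ) :
    ∃ c : ℝ → Space3, IsLoopParam c ∧ Set.range c = Γ ∧
      ∀ R : Space3 → Space3, Isometry R → R '' Γ = Γ → ∃ F, IsLift c R F := by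
  obtain ⟨γ, hγ, hinj, rfl⟩ := hΓ
  refine ⟨fun x : ℝ => γ x, isLoopParam_of_injective hγ hinj, ?_, fun R hR hRΓ =>
    exists_isLift hγ hinj hR.continuous hRΓ⟩
  exact (QuotientAddGroup.mk_surjective).range_comp γ

theorem IsKnot.isCompact {Γ : Set Space3} (hΓ : IsKnot Γ) : IsCompact Γ := by
  obtain ⟨γ, hγ, -, rfl⟩ := hΓ
  have : Fact ((0 : ℝ) < 1) := ⟨zero_lt_one⟩
  exact isCompact_range hγ

theorem IsKnot.nonempty {Γ : Set Space3} (hΓ : IsKnot Γ) : Γ.Nonempty := by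
  obtain ⟨γ, -, -, rfl⟩ := hΓ
  exact Set.range_nonempty γ

/-- A rotational symmetry of a knot whose axis meets the knot is a half turn. -/
theorem IsKnot.eq_pi_of_inter_axis_nonempty {Γ : Set Space3} (hΓ : IsKnot Γ)
    {v : AffineSubspace ℝ Space3} {φ : ℝ} (hφ : φ ∈ Set.Ioc (-Real.pi) Real.pi) (hφ0 : φ ≠ 0)
    (hsym : HasRotationalSymmetry Γ v φ) (hne : (Γ ∩ (v : Set Space3)).Nonempty) :
    φ = Real.pi := by
  obtain ⟨q, hqΓ, hqv⟩ := hne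
  obtain ⟨e, he, -, hR⟩ := hsym.exists_of_mem hqv
  obtain ⟨c, hc, rfl, hlift⟩ := hΓ.exists_isLoopParam
  have hiso := isometry_rotationAbout he q φ
  have hpi := Real.pi_pos
  have hcos : Real.cos φ ≠ 1 := by
    rw [Ne, Real.cos_eq_one_iff_of_lt_of_lt (by linarith [hφ.1]) (by linarith [hφ.2])]
    exact hφ0
  obtain ⟨F, hF⟩ := hlift _ hiso hR
  obtain ⟨x, hx⟩ := hqΓ
  rcases hF.pos_or_strictAnti hc hiso.injective with h | h
  · exact absurd (by rw [hx, rotationAbout_eq]; simp) (h.rotation_ne hc he hcos x)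
  · obtain ⟨n, hn⟩ := (Real.cos_eq_one_iff _).1 (hF.involutive_rotation_of_strictAnti hc he h.1).2
    have hn' : φ = n * Real.pi := by linarith
    have h1 : (n : ℝ) ≤ 1 := by
      have := hφ.2
      rw [hn'] at this
      nlinarith
    have h2 : (-1 : ℝ) < n := by
      have := hφ.1
      rw [hn'] at this
      nlinarith
    have h3 : n ≠ 0 := by
      rintro rfl
      simp at hn'
      exact hφ0 hn'
    norm_cast at h1 h2
    have h4 : n = 1 := by omega
    rw [hn', h4]
    simp

/-- The axes of any two rotational symmetries of a knot meet. -/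
theorem IsKnot.axes_inter_nonempty {Γ : Set Space3} (hΓ : IsKnot Γ)
    {v₁ v₂ : AffineSubspace ℝ Space3} {φ₁ φ₂ : ℝ} (h₁ : Real.cos φ₁ ≠ 1) (h₂ : Real.cos φ₂ ≠ 1)
    (hs₁ : HasRotationalSymmetry Γ v₁ φ₁) (hs₂ : HasRotationalSymmetry Γ v₂ φ₂) :
    ((v₁ : Set Space3) ∩ (v₂ : Set Space3)).Nonempty := by
  obtain ⟨z, hz⟩ := exists_fixed_of_isometry_image hΓ.isCompact hΓ.nonempty
  obtain ⟨p, e, he, rfl, hR⟩ := hs₁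
  obtain ⟨q, f, hf, rfl, hS⟩ := hs₂
  exact ⟨z,
    mem_axis_iff.2 (exists_eq_add_smul_of_rotationAbout_eq he h₁
      (hz _ (isometry_rotationAbout he p _) hR)),
    mem_axis_iff.2 (exists_eq_add_smul_of_rotationAbout_eq hf h₂
      (hz _ (isometry_rotationAbout hf q _) hS))⟩

theorem not_exists_eq_smul_of_inter_eq_singleton {p e f : Space3} (hf : ‖f‖ = 1)
    (h : (AffineSubspace.mk' p (Submodule.span ℝ {e}) : Set Space3) ∩
      (AffineSubspace.mk' p (Submodule.span ℝ {f}) : Set Space3) = {p}) :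
    ¬ ∃ t : ℝ, f = t • e := by
  rintro ⟨t, ht⟩
  have hmem : p + f ∈ ({p} : Set Space3) := by
    rw [← h]
    exact ⟨mem_axis_iff.2 ⟨t, by rw [ht]⟩, mem_axis_iff.2 ⟨1, by rw [one_smul]⟩⟩
  have hf0 : f = 0 := by simpa using hmem
  simp [hf0] at hf

/-- Rotational symmetries of a knot about two axes that meet in a single point cannot both have
order at least three. -/
theorem IsKnot.not_three_le_of_three_le {Γ : Set Space3} (hΓ : IsKnot Γ)
    {v₁ v₂ : AffineSubspace ℝ Space3} {a₁ a₂ : ℤ} {p : Space3}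
    (hs₁ : HasRotationalSymmetry Γ v₁ (2 * Real.pi / (a₁ : ℝ)))
    (hs₂ : HasRotationalSymmetry Γ v₂ (2 * Real.pi / (a₂ : ℝ)))
    (hp : (v₁ : Set Space3) ∩ (v₂ : Set Space3) = {p}) (ha₁ : 3 ≤ a₁) : ¬ 3 ≤ a₂ := by
  intro ha₂
  have hpm : p ∈ (v₁ : Set Space3) ∩ (v₂ : Set Space3) := hp ▸ rfl
  obtain ⟨e, he, rfl, hR⟩ := hs₁.exists_of_mem hpm.1
  obtain ⟨f, hf, rfl, hS⟩ := hs₂.exists_of_mem hpm.2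
  obtain ⟨c, hc, rfl, hlift⟩ := hΓ.exists_isLoopParam
  obtain ⟨F, hF⟩ := hlift _ (isometry_rotationAbout he p _) hR
  obtain ⟨G, hG⟩ := hlift _ (isometry_rotationAbout hf p _) hS
  exact not_exists_eq_smul_of_inter_eq_singleton hf hp
    ((hF.isPosLift_of_three_le hc he ha₁).exists_eq_smul hc he hf ha₁ (by omega)
      (hG.isPosLift_of_three_le hc hf ha₂))

/-- A half turn symmetry and a rotational symmetry of order at least three of a knot, about axes
that meet in a single point. -/
theorem IsKnot.half_turn_axis {Γ : Set Space3} (hΓ : IsKnot Γ)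
    {v w : AffineSubspace ℝ Space3} {a : ℤ} {p : Space3}
    (hs : HasRotationalSymmetry Γ v Real.pi)
    (ht : HasRotationalSymmetry Γ w (2 * Real.pi / (a : ℝ)))
    (hp : (v : Set Space3) ∩ (w : Set Space3) = {p}) (ha : 3 ≤ a) :
    Submodule.IsOrtho v.direction w.direction ∧ ((v : Set Space3) ∩ Γ).Nonempty ∧
      (w : Set Space3) ∩ Γ = ∅ := by
  have hpm : p ∈ (v : Set Space3) ∩ (w : Set Space3) := hp ▸ rfl
  obtain ⟨e, he, rfl, hR⟩ := hs.exists_of_mem hpm.1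
  obtain ⟨f, hf, rfl, hS⟩ := ht.exists_of_mem hpm.2
  obtain ⟨c, hc, rfl, hlift⟩ := hΓ.exists_isLoopParam
  obtain ⟨F, hF⟩ := hlift _ (isometry_rotationAbout he p _) hR
  obtain ⟨G, hG⟩ := hlift _ (isometry_rotationAbout hf p _) hS
  have hGpos := hG.isPosLift_of_three_le hc hf ha
  have hne := not_exists_eq_smul_of_inter_eq_singleton hf hp
  have ha1 : (1 : ℝ) < a := by exact_mod_cast (by omega : 1 < a)
  rcases hF.pos_or_strictAnti hc (isometry_rotationAbout he p _).injective with h | ⟨hanti, -⟩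
  · have h' : IsPosLift c (rotationAbout p e (2 * Real.pi / ((2 : ℤ) : ℝ))) F := by
      convert h using 2
      push_cast
      ring
    rw [Set.inter_comm] at hp
    exact absurd (hGpos.exists_eq_smul hc hf he ha le_rfl h')
      (not_exists_eq_smul_of_inter_eq_singleton he hp)
  · have hinner := (hF.exists_eq_smul_or_inner_eq_zero hc he hf (by omega) hanti hGpos).resolve_left
      hne
    refine ⟨?_, ?_, ?_⟩
    · rw [AffineSubspace.direction_mk', AffineSubspace.direction_mk', Submodule.isOrtho_span]
      rintro _ rfl _ rfl
      exact hinner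
    · obtain ⟨x, hx⟩ := (hF.involutive_rotation_of_strictAnti hc he hanti).1
      exact ⟨c x, mem_axis_iff.2 (exists_eq_add_smul_of_rotationAbout_eq he (by norm_num) hx),
        x, rfl⟩
    · rw [Set.eq_empty_iff_forall_notMem]
      rintro _ ⟨hw, x, rfl⟩
      obtain ⟨t, ht'⟩ := mem_axis_iff.1 hw
      refine hGpos.rotation_ne hc hf (cos_two_pi_div_ne_one ha1) x ?_
      rw [ht', rotationAbout_eq, add_sub_cancel_left, map_smul, rotationLinear_self hf]

theorem theorem4p10 (Γ : Set Space3) (hΓ : IsTameKnot Γ) (hΓ' : ¬ IsTrivialKnot Γ) :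
    (∀ (v : AffineSubspace ℝ Space3) (φ : ℝ), φ ∈ Set.Ioc (-Real.pi) Real.pi → φ ≠ 0 →
      HasRotationalSymmetry Γ v φ → (Γ ∩ (v : Set Space3)).Nonempty → φ = Real.pi) ∧
    (∀ (v₁ v₂ : AffineSubspace ℝ Space3) (a₁ a₂ : ℤ) (φ₁ φ₂ : ℝ), 2 ≤ a₁ → 2 ≤ a₂ →
      φ₁ = 2 * Real.pi / (a₁ : ℝ) → φ₂ = 2 * Real.pi / (a₂ : ℝ) →
      HasRotationalSymmetry Γ v₁ φ₁ → HasRotationalSymmetry Γ v₂ φ₂ →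
      ((v₁ : Set Space3) ∩ (v₂ : Set Space3)).Nonempty ∧
      ∀ p : Space3, (v₁ : Set Space3) ∩ (v₂ : Set Space3) = {p} →
        (φ₁ ≠ φ₂ →
          Submodule.IsOrtho v₁.direction v₂.direction ∧
          ((a₁ = 2 ∧ 3 ≤ a₂) ∨ (a₂ = 2 ∧ 3 ≤ a₁)) ∧
          (a₁ = 2 → ((v₁ : Set Space3) ∩ Γ).Nonempty ∧ (v₂ : Set Space3) ∩ Γ = ∅) ∧
          (a₂ = 2 → ((v₂ : Set Space3) ∩ Γ).Nonempty ∧ (v₁ : Set Space3) ∩ Γ = ∅)) ∧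
        (φ₁ = φ₂ → φ₁ = Real.pi ∧ φ₂ = Real.pi)) := by
  have hK := hΓ.1
  refine ⟨fun v φ hφ hφ0 hsym hne => hK.eq_pi_of_inter_axis_nonempty hφ hφ0 hsym hne, ?_⟩
  rintro v₁ v₂ a₁ a₂ _ _ ha₁ ha₂ rfl rfl hs₁ hs₂
  have hlt : ∀ a : ℤ, 2 ≤ a → (1 : ℝ) < a := fun a ha => by exact_mod_cast (by omega : 1 < a)
  refine ⟨hK.axes_inter_nonempty (cos_two_pi_div_ne_one (hlt a₁ ha₁))
    (cos_two_pi_div_ne_one (hlt a₂ ha₂)) hs₁ hs₂, fun p hp => ?_⟩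
  have htwo : 2 * Real.pi / ((2 : ℤ) : ℝ) = Real.pi := by
    push_cast
    ring
  have hnot := fun h => hK.not_three_le_of_three_le hs₁ hs₂ hp h
  refine ⟨fun hne => ?_, fun heq => ?_⟩
  · have hcases : (a₁ = 2 ∧ 3 ≤ a₂) ∨ (a₂ = 2 ∧ 3 ≤ a₁) := by
      have : a₁ ≠ a₂ := fun h => hne (by rw [h])
      by_cases h3 : 3 ≤ a₁
      · have := hnot h3
        right
        omega
      · left
        omega
    rcases hcases with ⟨rfl, h3⟩ | ⟨rfl, h3⟩
    · rw [htwo] at hs₁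
      obtain ⟨h1, h2⟩ := hK.half_turn_axis hs₁ hs₂ hp h3
      exact ⟨h1, Or.inl ⟨rfl, h3⟩, fun _ => h2, fun h => absurd h (by omega)⟩
    · rw [htwo] at hs₂
      rw [Set.inter_comm] at hp
      obtain ⟨h1, h2⟩ := hK.half_turn_axis hs₂ hs₁ hp h3
      exact ⟨h1.symm, Or.inr ⟨rfl, h3⟩, fun h => absurd h (by omega), fun _ => h2⟩
  · have h12 : a₁ = a₂ := by
      have h1 := hlt a₁ ha₁
      have h2 := hlt a₂ ha₂
      have hpi := Real.pi_pos
      rw [div_eq_div_iff (by linarith) (by linarith)] at heq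
      have := mul_left_cancel₀ (by positivity) heq
      exact_mod_cast this.symm
    subst h12
    have h2 : a₁ = 2 := by
      by_contra hne
      exact hnot (by omega) (by omega)
    subst h2
    exact ⟨htwo, htwo⟩
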